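/- **Theorem 4.7.** Let $H$ be a complex Hilbert space, let $N\subseteq B(H)$ be a von Neumann algebra, and let $\mathcal V(N)$ be a family of commutative von Neumann subalgebras of $N$ containing the unit of $N$, ordered by inclusion. For $A\in\mathcal V(N)$ let $\Sigma(A)$ be its Gelfand spectrum, i.e. the set of multiplicative states (nonzero multiplicative norm-continuous linear functionals $A\to\mathbb C$) with the weak$^*$ topology. The spectral presheaf $\Sigma:\mathcal V(N)^{op}\to\mathbf{Set}$ sends $A$ to $\Sigma(A)$ and an inclusion $A\subseteq A'$ to the restriction map $\Sigma(A')\to\Sigma(A)$. Let $\mathrm{Sub}_{cl}(\Sigma)$ be the complete Heyting algebra, ordered by inclusion, of the subfunctors $T$ of $\Sigma$ with $T(A)$ clopen in $\Sigma(A)$ for every $A\in\mathcal V(N)$. For a complete Heyting algebra $L$, a modal operator (nucleus) on $L$ is a map $j:L\to L$ with $x\le j(x)$, $j(j(x))=j(x)$ and $j(x\wedge y)=j(x)\wedge j(y)$; ordered pointwise, these form a complete Heyting algebra $M(L)$. For $a\in L$ put $\Diamond_a(x)=a\vee x$ and $\Diamond_{a\to}(x)=a\to x$. Let $\mathrm{Reg}(M(L))=\{j\in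 M(L):\neg\neg j=j\}$ be the Boolean algebra of regular elements of $M(L)$, and let $L^{\Diamond}$ be its Boolean subalgebra generated by $\{\Diamond_a,\Diamond_{a\to}:a\in L\}$. Let $\mathcal C_0:L\to L^{\Diamond}$ be the embedding of bounded lattices $\mathcal C_0(a)=\Diamond_a$. Let $B$ be a Boolean algebra and let $f:\mathrm{Sub}_{cl}(\Sigma)\to B$ be a classical interpretation, that is, an injective map preserving $\vee,\wedge,0,1$. Then there is a unique Boolean homomorphism $\widehat f:\mathrm{Sub}_{cl}(\Sigma)^{\Diamond}\to B$ with $\widehat f(\Diamond_a)=f(a)$ for all $a\in\mathrm{Sub}_{cl}(\Sigma)$, and $\widehat f$ is injective. -/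

import Mathlib

universe u

section Spectrum

variable {H : Type u} [NormedAddCommGroup H] [InnerProductSpace ℂ H] [CompleteSpace H]

/-- A context of `N`: a commutative von Neumann algebra contained in `N`, acting on the same
Hilbert space and hence with the same unit. -/
structure AbelianSubalgebra (N : VonNeumannAlgebra H) where
  alg : VonNeumannAlgebra H
  le : alg ≤ N
  comm : ∀ x ∈ alg, ∀ y ∈ alg, x * y = y * x

namespace AbelianSubalgebra

variable {N : VonNeumannAlgebra H}

/-- Contexts are ordered by inclusion. -/
instance : PartialOrder (AbelianSubalgebra N) :=
  PartialOrder.lift alg (fun A B h => by cases A; cases B; congr)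

/-- The Gelfand spectrum: the multiplicative states (nonzero multiplicative continuous linear
functionals) of `A`, with the weak-* topology. -/
abbrev Spectrum (A : AbelianSubalgebra N) : Type u :=
  WeakDual.characterSpace ℂ A.alg.toStarSubalgebra

theorem isClosed (A : AbelianSubalgebra N) :
    IsClosed (A.alg.toStarSubalgebra : Set (H →L[ℂ] H)) := by
  rw [VonNeumannAlgebra.coe_toStarSubalgebra, ← A.alg.centralizer_centralizer]
  exact Set.isClosed_centralizer _

noncomputable def inclusion {A B : AbelianSubalgebra N} (h : A ≤ B) :
    A.alg.toStarSubalgebra →L[ℂ] B.alg.toStarSubalgebra where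
  toFun x := ⟨x.1, h x.2⟩
  map_add' _ _ := rfl
  map_smul' _ _ := rfl
  cont := by fun_prop

/-- Restriction of multiplicative states along an inclusion of contexts. -/
noncomputable def restrict {A B : AbelianSubalgebra N} (h : A ≤ B) (s : B.Spectrum) : A.Spectrum :=
  ⟨(WeakDual.CharacterSpace.toCLM s).comp (inclusion h), by
    have h1 : s (1 : B.alg.toStarSubalgebra) = 1 := map_one s
    refine ⟨fun h0 => ?_, fun x y => map_mul s (inclusion h x) (inclusion h y)⟩
    have := DFunLike.congr_fun h0 (1 : A.alg.toStarSubalgebra)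
    exact one_ne_zero (h1.symm.trans this)⟩

theorem restrict_apply {A B : AbelianSubalgebra N} (h : A ≤ B) (s : B.Spectrum)
    (x : A.alg.toStarSubalgebra) : restrict h s x = s (⟨x.1, h x.2⟩ : B.alg.toStarSubalgebra) := rfl

theorem continuous_restrict {A B : AbelianSubalgebra N} (h : A ≤ B) :
    Continuous (restrict h) := by
  refine Continuous.subtype_mk (WeakDual.continuous_of_continuous_eval fun x => ?_) _
  exact (WeakDual.eval_continuous (inclusion h x)).comp continuous_subtype_val

noncomputable abbrev commCStarAlgebra (A : AbelianSubalgebra N) :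
    CommCStarAlgebra A.alg.toStarSubalgebra :=
  { StarSubalgebra.cstarAlgebra A.alg.toStarSubalgebra (h_closed := A.isClosed) with
    mul_comm := fun x y => Subtype.ext (A.comm x.1 x.2 y.1 y.2) }

/-- Surjectivity of the Gelfand transform. -/
theorem exists_gelfand (A : AbelianSubalgebra N) (f : C(A.Spectrum, ℂ)) :
    ∃ a : A.alg.toStarSubalgebra, ∀ s : A.Spectrum, s a = f s := by
  let := A.commCStarAlgebra
  obtain ⟨a, ha⟩ := (gelfandTransform_bijective A.alg.toStarSubalgebra).2 f
  exact ⟨a, fun s => DFunLike.congr_fun ha s⟩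

/-- Injectivity of the Gelfand transform. -/
theorem ext_gelfand (A : AbelianSubalgebra N) {a b : A.alg.toStarSubalgebra}
    (h : ∀ s : A.Spectrum, s a = s b) : a = b := by
  let := A.commCStarAlgebra
  exact (gelfandTransform_bijective A.alg.toStarSubalgebra).1 (ContinuousMap.ext h)

instance (A : AbelianSubalgebra N) : CompactSpace A.Spectrum := by
  let := A.commCStarAlgebra
  exact inferInstanceAs (CompactSpace (WeakDual.characterSpace ℂ A.alg.toStarSubalgebra))

theorem exists_separating (A : AbelianSubalgebra N) {C : Set A.Spectrum} (hC : IsClosed C)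
    {s : A.Spectrum} (hs : s ∉ C) :
    ∃ a : A.alg.toStarSubalgebra, s a = 1 ∧ ∀ t ∈ C, t a = 0 := by
  obtain ⟨f, h0, h1, -⟩ := exists_continuous_zero_one_of_isClosed hC
    (isClosed_singleton (x := s)) (Set.disjoint_singleton_right.2 hs)
  obtain ⟨a, ha⟩ := A.exists_gelfand ⟨fun t => (f t : ℂ), by fun_prop⟩
  refine ⟨a, ?_, fun t ht => ?_⟩
  · simp [ha, h1 rfl]
  · simp [ha, h0 ht]

/-- The spectrum of a commutative von Neumann algebra is extremally disconnected; this is what makes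
the lattice of clopen subobjects complete. -/
instance (A : AbelianSubalgebra N) : ExtremallyDisconnected A.Spectrum where
  open_closure U hU := by
    let I : Set A.alg.toStarSubalgebra := {a | ∀ s : A.Spectrum, s ∉ U → s a = 0}
    let K : Submodule ℂ H :=
      (Submodule.span ℂ {z | ∃ a ∈ I, ∃ x : H, z = a.1 x}).topologicalClosure
    have : CompleteSpace K :=
      (Submodule.isClosed_topologicalClosure _).completeSpace_coe
    have hI : ∀ a ∈ I, ∀ x : H, a.1 x ∈ K := fun a ha x =>
      Submodule.le_topologicalClosure _ (Submodule.subset_span ⟨a, ha, x, rfl⟩)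
    have hK : ∀ y : H →L[ℂ] H, (∀ a ∈ I, ∀ x, y (a.1 x) ∈ K) → ∀ z ∈ K, y z ∈ K := by
      intro y hy z hz
      have hle : (Submodule.span ℂ {z | ∃ a ∈ I, ∃ x : H, z = a.1 x}).topologicalClosure ≤
          K.comap (y : H →ₗ[ℂ] H) := by
        refine Submodule.topologicalClosure_minimal _ (Submodule.span_le.2 ?_) ?_
        · rintro _ ⟨a, ha, x, rfl⟩
          exact hy a ha x
        · exact (Submodule.isClosed_topologicalClosure _).preimage y.continuous
      exact hle hz
    have hP : K.starProjection ∈ A.alg := by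
      rw [VonNeumannAlgebra.IsStarProjection.mem_iff isStarProjection_starProjection]
      intro y hy z hz
      have hr : K.starProjection.range = K := Submodule.range_starProjection K
      rw [hr] at hz ⊢
      refine hK y (fun a ha x => ?_) z hz
      have := DFunLike.congr_fun (VonNeumannAlgebra.mem_commutant_iff.1 hy a.1 a.2) x
      have h2 : y (a.1 x) = a.1 (y x) := this.symm
      rw [h2]
      exact hI a ha _
    let P : A.alg.toStarSubalgebra := ⟨K.starProjection, hP⟩
    have hPI : ∀ a ∈ I, P * a = a := fun a ha => Subtype.ext <| ContinuousLinearMap.ext fun x =>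
      Submodule.starProjection_eq_self_iff.2 (hI a ha x)
    have hPP : P * P = P := Subtype.ext isStarProjection_starProjection.isIdempotentElem
    have h01 : ∀ s : A.Spectrum, s P = 0 ∨ s P = 1 := fun s => by
      have h : s P * s P = s P := by rw [← map_mul, hPP]
      have h' : s P * (s P - 1) = 0 := by rw [mul_sub, h, mul_one, sub_self]
      exact (mul_eq_zero.1 h').imp_right sub_eq_zero.1
    have hcont : Continuous fun s : A.Spectrum => s P :=
      (WeakDual.eval_continuous P).comp continuous_subtype_val
    have hcl : closure U = {s : A.Spectrum | s P = 1} := by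
      apply Set.Subset.antisymm
      · refine closure_minimal (fun s hs => ?_) (isClosed_singleton.preimage hcont)
        obtain ⟨g, hg1, hg0⟩ := A.exists_separating hU.isClosed_compl (s := s) (by simpa using hs)
        have := congrArg s (hPI g hg0)
        rwa [map_mul, hg1, mul_one] at this
      · intro s hs
        by_contra hsU
        obtain ⟨g, hg1, hg0⟩ := A.exists_separating isClosed_closure hsU
        have hg : ∀ a ∈ I, g * a = 0 := fun a ha => A.ext_gelfand fun t => by
          rw [map_mul, map_zero]
          by_cases ht : t ∈ U
          · rw [hg0 t (subset_closure ht), zero_mul]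
          · rw [ha t ht, mul_zero]
        have hker : K ≤ (g.1 : H →ₗ[ℂ] H).ker := by
          refine Submodule.topologicalClosure_minimal _ (Submodule.span_le.2 ?_) ?_
          · rintro _ ⟨a, ha, x, rfl⟩
            exact DFunLike.congr_fun (congrArg Subtype.val (hg a ha)) x
          · exact g.1.isClosed_ker
        have hgP : g * P = 0 := Subtype.ext <| ContinuousLinearMap.ext fun x =>
          hker (Submodule.starProjection_apply_mem K x)
        have := congrArg s hgP
        rw [map_mul, hg1, one_mul, map_zero] at this
        have hs' : s P = 1 := hs
        rw [hs'] at this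
        exact one_ne_zero this
    have : {s : A.Spectrum | s P = 1} = {s : A.Spectrum | s P ∈ ({0}ᶜ : Set ℂ)} := by
      ext s
      rcases h01 s with h | h <;> simp [h]
    rw [hcl, this]
    exact isOpen_compl_singleton.preimage hcont

end AbelianSubalgebra
end Spectrum

section Presheaf

open CategoryTheory Opposite

variable {H : Type u} [NormedAddCommGroup H] [InnerProductSpace ℂ H] [CompleteSpace H]
  {N : VonNeumannAlgebra H}

/-- The spectral presheaf over a family `V` of contexts, viewed as a poset category: a context goes
to its spectrum, an inclusion to the restriction map. -/
noncomputable def spectralPresheaf (V : Set (AbelianSubalgebra N)) : (↥V)ᵒᵖ ⥤ Type u where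
  obj A := A.unop.1.Spectrum
  map i := ↾(AbelianSubalgebra.restrict (leOfHom i.unop))

/-- A clopen subobject of the spectral presheaf: a subfunctor with clopen components. -/
@[ext]
structure ClopenSubobject (V : Set (AbelianSubalgebra N)) where
  toSubfunctor : Subfunctor (spectralPresheaf V)
  isClopen' : ∀ A : V, IsClopen (X := A.1.Spectrum) (toSubfunctor.obj (op A))

namespace ClopenSubobject

variable {V : Set (AbelianSubalgebra N)}

/-- The component of a clopen subobject at a context. -/
def val (T : ClopenSubobject V) (A : V) : Set A.1.Spectrum := T.toSubfunctor.obj (op A)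

theorem isClopen (T : ClopenSubobject V) (A : V) : IsClopen (T.val A) := T.isClopen' A

theorem restrict_mem (T : ClopenSubobject V) {A B : V} (h : A ≤ B) {s : B.1.Spectrum}
    (hs : s ∈ T.val B) : AbelianSubalgebra.restrict h s ∈ T.val A :=
  T.toSubfunctor.map (homOfLE h).op hs

/-- Constructor from the components. -/
noncomputable def mk' (T : ∀ A : V, Set A.1.Spectrum) (hT : ∀ A, IsClopen (T A))
    (hres : ∀ (A B : V) (h : A ≤ B), ∀ s ∈ T B, AbelianSubalgebra.restrict h s ∈ T A) :
    ClopenSubobject V where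
  toSubfunctor :=
    { obj := fun A => T A.unop
      map := fun i s hs => hres _ _ (leOfHom i.unop) s hs }
  isClopen' := hT

@[simp] theorem val_mk' (T : ∀ A : V, Set A.1.Spectrum) (hT hres) (A : V) :
    (mk' T hT hres).val A = T A := rfl

/-- Clopen subobjects are ordered by inclusion. -/
noncomputable instance : PartialOrder (ClopenSubobject V) :=
  PartialOrder.lift toSubfunctor (fun _ _ => ClopenSubobject.ext)

theorem le_iff {S T : ClopenSubobject V} : S ≤ T ↔ ∀ A, S.val A ⊆ T.val A :=
  ⟨fun h A => h (op A), fun h A => h A.unop⟩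

noncomputable instance : Max (ClopenSubobject V) :=
  ⟨fun S T => mk' (fun A => S.val A ∪ T.val A) (fun A => (S.isClopen A).union (T.isClopen A))
    fun _ _ h _ hs => hs.imp (S.restrict_mem h) (T.restrict_mem h)⟩

noncomputable instance : Min (ClopenSubobject V) :=
  ⟨fun S T => mk' (fun A => S.val A ∩ T.val A) (fun A => (S.isClopen A).inter (T.isClopen A))
    fun _ _ h _ hs => ⟨S.restrict_mem h hs.1, T.restrict_mem h hs.2⟩⟩

noncomputable instance : Top (ClopenSubobject V) :=
  ⟨mk' (fun _ => Set.univ) (fun _ => isClopen_univ) fun _ _ _ _ _ => trivial⟩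

noncomputable instance : Bot (ClopenSubobject V) :=
  ⟨mk' (fun _ => ∅) (fun _ => isClopen_empty) fun _ _ _ _ hs => hs.elim⟩

noncomputable instance : SupSet (ClopenSubobject V) :=
  ⟨fun 𝒯 => mk' (fun A => closure (⋃ T ∈ 𝒯, T.val A))
    (fun A => ⟨isClosed_closure, ExtremallyDisconnected.open_closure _
      (isOpen_biUnion fun T _ => (T.isClopen A).isOpen)⟩)
    fun A B h s hs => by
      refine map_mem_closure (AbelianSubalgebra.continuous_restrict h) hs fun t ht => ?_
      obtain ⟨T, hT, ht⟩ := Set.mem_iUnion₂.1 ht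
      exact Set.mem_iUnion₂.2 ⟨T, hT, T.restrict_mem h ht⟩⟩

@[simp] theorem val_sup (S T : ClopenSubobject V) (A : V) :
    (S ⊔ T).val A = S.val A ∪ T.val A := rfl
@[simp] theorem val_inf (S T : ClopenSubobject V) (A : V) :
    (S ⊓ T).val A = S.val A ∩ T.val A := rfl
@[simp] theorem val_top (A : V) : (⊤ : ClopenSubobject V).val A = Set.univ := rfl
@[simp] theorem val_bot (A : V) : (⊥ : ClopenSubobject V).val A = ∅ := rfl
theorem val_sSup (𝒯 : Set (ClopenSubobject V)) (A : V) :
    (sSup 𝒯).val A = closure (⋃ T ∈ 𝒯, T.val A) := rfl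

noncomputable instance : CompleteLattice (ClopenSubobject V) :=
  { completeLatticeOfSup (ClopenSubobject V) fun 𝒯 =>
      ⟨fun T hT => le_iff.2 fun A =>
          (Set.subset_biUnion_of_mem (u := fun T : ClopenSubobject V => T.val A) hT).trans
            subset_closure,
        fun S hS => le_iff.2 fun A => closure_minimal
          (Set.iUnion₂_subset fun _ hT => le_iff.1 (hS hT) A) (S.isClopen A).isClosed⟩ with
    sup := (· ⊔ ·)
    le_sup_left := fun _ _ => le_iff.2 fun _ => Set.subset_union_left
    le_sup_right := fun _ _ => le_iff.2 fun _ => Set.subset_union_right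
    sup_le := fun _ _ _ h₁ h₂ => le_iff.2 fun A =>
      Set.union_subset (le_iff.1 h₁ A) (le_iff.1 h₂ A)
    inf := (· ⊓ ·)
    inf_le_left := fun _ _ => le_iff.2 fun _ => Set.inter_subset_left
    inf_le_right := fun _ _ => le_iff.2 fun _ => Set.inter_subset_right
    le_inf := fun _ _ _ h₁ h₂ => le_iff.2 fun A =>
      Set.subset_inter (le_iff.1 h₁ A) (le_iff.1 h₂ A)
    top := ⊤
    le_top := fun _ => le_iff.2 fun _ => Set.subset_univ _
    bot := ⊥
    bot_le := fun _ => le_iff.2 fun _ => Set.empty_subset _ }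

/-- The complete Heyting algebra of clopen subobjects; finite joins and meets are pointwise. -/
noncomputable instance : Order.Frame (ClopenSubobject V) :=
  Order.Frame.ofMinimalAxioms
    { inf_sSup_le_iSup_inf := fun S 𝒯 => le_iff.2 fun A => by
        have h1 : ∀ T ∈ 𝒯, S.val A ∩ T.val A ⊆ (⨆ T ∈ 𝒯, S ⊓ T : ClopenSubobject V).val A :=
          fun T hT => le_iff.1 (le_iSup₂ (f := fun T (_ : T ∈ 𝒯) => S ⊓ T) T hT) A
        have h2 : (S ⊓ sSup 𝒯).val A = S.val A ∩ closure (⋃ T ∈ 𝒯, T.val A) := rfl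
        rw [h2]
        refine (S.isClopen A).isOpen.inter_closure.trans (closure_minimal ?_
          (ClopenSubobject.isClopen _ A).isClosed)
        rw [Set.inter_iUnion₂]
        exact Set.iUnion₂_subset h1 }

end ClopenSubobject

end Presheaf

section Modal

variable {A : Type*} [Order.Frame A]

/-- The closed modal operator `x ↦ a ⊔ x`. Modal operators are Mathlib's nuclei, ordered pointwise. -/
def closedNucleus (a : A) : Nucleus A where
  toFun x := a ⊔ x
  map_inf' := sup_inf_left a
  idempotent' x := by simp
  le_apply' _ := le_sup_right

/-- The open modal operator `x ↦ a ⇨ x`. -/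
def openNucleus (a : A) : Nucleus A where
  toFun x := a ⇨ x
  map_inf' x y := himp_inf_distrib a x y
  idempotent' x := by simp
  le_apply' _ := le_himp

theorem isCompl_closedNucleus_openNucleus (a : A) : IsCompl (closedNucleus a) (openNucleus a) := by
  constructor
  · rw [disjoint_iff_inf_le]
    intro x
    change (a ⊔ x) ⊓ (a ⇨ x) ≤ x
    rw [inf_sup_right, inf_himp]
    exact sup_le inf_le_right inf_le_left
  · rw [codisjoint_iff_le_sup]
    intro x
    have h : (openNucleus a) (closedNucleus a x) = ⊤ :=
      himp_eq_top_iff.2 (le_sup_left : a ≤ a ⊔ x)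
    set j := closedNucleus a ⊔ openNucleus a
    calc ⊤ = (openNucleus a) (closedNucleus a x) := h.symm
      _ ≤ j (j x) := ((le_sup_right : openNucleus a ≤ j) _).trans
          (j.monotone ((le_sup_left : closedNucleus a ≤ j) x))
      _ = j x := j.idempotent x

/-- The closed modal operator as a regular element of the Heyting algebra of modal operators. -/
def closedReg (a : A) : Heyting.Regular (Nucleus A) :=
  ⟨closedNucleus a, by
    have h := isCompl_closedNucleus_openNucleus a
    rw [Heyting.IsRegular, h.compl_eq, h.symm.compl_eq]⟩

/-- The open modal operator as a regular element of the Heyting algebra of modal operators. -/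
def openReg (a : A) : Heyting.Regular (Nucleus A) :=
  ⟨openNucleus a, by
    have h := isCompl_closedNucleus_openNucleus a
    rw [Heyting.IsRegular, h.symm.compl_eq, h.compl_eq]⟩

/-- The Boolean subalgebra of the regular modal operators generated by all closed and all open modal
operators. -/
def diamondAlgebra (A : Type*) [Order.Frame A] : BooleanSubalgebra (Heyting.Regular (Nucleus A)) :=
  BooleanSubalgebra.closure (Set.range closedReg ∪ Set.range openReg)

theorem closedReg_sup (a b : A) : closedReg (a ⊔ b) = closedReg a ⊔ closedReg b := by
  apply le_antisymm
  · have h : closedNucleus (a ⊔ b) ≤ closedNucleus a ⊔ closedNucleus b := fun x => by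
      set j := closedNucleus a ⊔ closedNucleus b
      have ha : a ⊔ x ≤ j x := (le_sup_left : closedNucleus a ≤ j) x
      have hb : b ⊔ x ≤ j x := (le_sup_right : closedNucleus b ≤ j) x
      exact sup_le (sup_le (le_sup_left.trans ha) (le_sup_left.trans hb)) (le_sup_right.trans ha)
    exact Heyting.Regular.coe_le_coe.1 (h.trans le_compl_compl)
  · exact sup_le
      (fun x => sup_le_sup_right (le_sup_left : a ≤ a ⊔ b) x)
      (fun x => sup_le_sup_right (le_sup_right : b ≤ a ⊔ b) x)

/-- The canonical map sending `a` to its closed modal operator. -/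
def diamond : BoundedLatticeHom A (diamondAlgebra A) where
  toFun a := ⟨closedReg a, BooleanSubalgebra.subset_closure (Or.inl ⟨a, rfl⟩)⟩
  map_sup' a b := Subtype.ext (closedReg_sup a b)
  map_inf' a b := Subtype.ext <| Heyting.Regular.coe_injective <| Nucleus.ext fun x =>
    sup_inf_right a b x
  map_top' := Subtype.ext <| Heyting.Regular.coe_injective <| Nucleus.ext fun x => top_sup_eq x
  map_bot' := Subtype.ext <| Heyting.Regular.coe_injective <| Nucleus.ext fun x => bot_sup_eq x

theorem diamond_apply (a x : A) : (diamond a).1.val x = a ⊔ x := rfl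

theorem diamond_injective : Function.Injective (diamond : A → diamondAlgebra A) := fun a b h => by
  have h' : ∀ x, a ⊔ x = b ⊔ x := fun x => by rw [← diamond_apply, h, diamond_apply]
  simpa using h' ⊥
end Modal

/-! The statement is an instance of a fact about a bounded distributive lattice `L` embedded by `i`
in a Boolean algebra `D` that its image generates: every injective bounded lattice homomorphism `f :
L → B` extends uniquely to `D`, and the extension is injective. The extension is built as a graph,
the subalgebra of `D × B` generated by the pairs `(i a, f a)`. Its elements are finite joins of
differences of such pairs, and `i a \ i b` vanishes exactly when `a ≤ b`, that is, exactly when `f a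
\ f b` vanishes. So the two coordinates vanish together (`fst_eq_bot_iff_of_mem_graphSubalgebra`);
applied to symmetric differences, this makes the graph single-valued and injective. For `diamond`
the generation hypothesis holds because open modal operators are complements of closed ones
(`closure_range_diamond`). -/

section BooleanExtension

variable {L D B : Type*} [DistribLattice L] [BoundedOrder L] [BooleanAlgebra D] [BooleanAlgebra B]

/-- Two bounded lattice homomorphisms between Boolean algebras that agree on a generating set
are equal. -/
theorem BoundedLatticeHom.ext_of_closure_eq_top {s : Set D}
    (hs : BooleanSubalgebra.closure s = ⊤) {g g' : BoundedLatticeHom D B}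
    (h : ∀ x ∈ s, g x = g' x) : g = g' := by
  ext x
  have hx : x ∈ BooleanSubalgebra.closure s := hs ▸ BooleanSubalgebra.mem_top
  induction hx using BooleanSubalgebra.closure_bot_sup_induction with
  | mem x hx => exact h x hx
  | bot => rw [map_bot, map_bot]
  | sup x _ y _ hx hy => rw [map_sup, map_sup, hx, hy]
  | compl x _ hx => rw [map_compl', map_compl', hx]

/-- The Boolean subalgebra of `D × B` generated by the pairs `(i a, f a)`. -/
def graphSubalgebra (i : BoundedLatticeHom L D) (f : BoundedLatticeHom L B) :
    BooleanSubalgebra (D × B) :=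
  BooleanSubalgebra.closure (Set.range fun a => (i a, f a))

variable {i : BoundedLatticeHom L D} {f : BoundedLatticeHom L B}

theorem mk_mem_graphSubalgebra (a : L) : (i a, f a) ∈ graphSubalgebra i f :=
  BooleanSubalgebra.subset_closure ⟨a, rfl⟩

/-- Totality of the graph: its projection to `D` is a subalgebra containing the generators `i a`. -/
theorem exists_mem_graphSubalgebra (hs : BooleanSubalgebra.closure (Set.range i) = ⊤) (x : D) :
    ∃ y : B, (x, y) ∈ graphSubalgebra i f := by
  have hx : x ∈ BooleanSubalgebra.closure (Set.range i) := hs ▸ BooleanSubalgebra.mem_top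
  induction hx using BooleanSubalgebra.closure_bot_sup_induction with
  | mem x hx =>
    obtain ⟨a, rfl⟩ := hx
    exact ⟨f a, mk_mem_graphSubalgebra a⟩
  | bot => exact ⟨⊥, BooleanSubalgebra.bot_mem⟩
  | sup x _ y _ hx hy =>
    obtain ⟨⟨x', hx⟩, ⟨y', hy⟩⟩ := And.intro hx hy
    exact ⟨x' ⊔ y', BooleanSubalgebra.sup_mem hx hy⟩
  | compl x _ hx =>
    obtain ⟨x', hx⟩ := hx
    exact ⟨x'ᶜ, BooleanSubalgebra.compl_mem hx⟩

/-- Both sides amount to `a ⊓ b = a`, an equation that injective lattice homomorphisms preserve and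
reflect. -/
theorem le_iff_le_of_injective (hi : Function.Injective i) (hf : Function.Injective f) (a b : L) :
    i a ≤ i b ↔ f a ≤ f b := by
  rw [← inf_eq_left, ← inf_eq_left, ← map_inf, ← map_inf, hi.eq_iff, hf.eq_iff]

theorem fst_eq_bot_iff_of_mem_graphSubalgebra (hi : Function.Injective i)
    (hf : Function.Injective f) {p : D × B} (hp : p ∈ graphSubalgebra i f) :
    p.1 = ⊥ ↔ p.2 = ⊥ := by
  -- The generating pairs form a sublattice containing `⊥` and `⊤`, so it suffices to treat
  -- differences of generators and binary joins.
  refine BooleanSubalgebra.closure_sdiff_sup_induction (s := Set.range fun a => (i a, f a))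
    (p := fun p _ => p.1 = ⊥ ↔ p.2 = ⊥) ⟨?_, ?_⟩ ⟨⊥, by simp [Prod.ext_iff]⟩
    ⟨⊤, by simp [Prod.ext_iff]⟩ ?_ ?_ p hp
  · rintro _ ⟨a, rfl⟩ _ ⟨b, rfl⟩
    exact ⟨a ⊔ b, by simp⟩
  · rintro _ ⟨a, rfl⟩ _ ⟨b, rfl⟩
    exact ⟨a ⊓ b, by simp⟩
  · rintro _ ⟨a, rfl⟩ _ ⟨b, rfl⟩
    simpa using le_iff_le_of_injective hi hf a b
  · rintro x - y - hx hy
    rw [Prod.fst_sup, Prod.snd_sup, sup_eq_bot_iff, sup_eq_bot_iff, hx, hy]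

/-- Two elements of a Boolean algebra are equal iff their symmetric difference vanishes. Left to
right the graph is single-valued; right to left it is injective. -/
theorem fst_eq_iff_of_mem_graphSubalgebra (hi : Function.Injective i) (hf : Function.Injective f)
    {x x' : D} {y y' : B} (h : (x, y) ∈ graphSubalgebra i f) (h' : (x', y') ∈ graphSubalgebra i f) :
    x = x' ↔ y = y' := by
  have key := fst_eq_bot_iff_of_mem_graphSubalgebra hi hf (BooleanSubalgebra.sup_mem
    (BooleanSubalgebra.sdiff_mem h h') (BooleanSubalgebra.sdiff_mem h' h))
  rw [le_antisymm_iff, le_antisymm_iff]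
  simpa using key

/-- An injective homomorphism from a bounded distributive lattice to a Boolean algebra extends to
an injective homomorphism on any Boolean algebra generated by the lattice. -/
theorem exists_injective_extension (hi : Function.Injective i) (hf : Function.Injective f)
    (hs : BooleanSubalgebra.closure (Set.range i) = ⊤) :
    ∃ g : BoundedLatticeHom D B, Function.Injective g ∧ ∀ a, g (i a) = f a := by
  choose g hg using exists_mem_graphSubalgebra (f := f) hs
  -- Single-valuedness: since the graph is closed under the Boolean operations, `g` preserves each
  -- of them.
  have hgr {x : D} {y : B} (h : (x, y) ∈ graphSubalgebra i f) : g x = y :=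
    (fst_eq_iff_of_mem_graphSubalgebra hi hf (hg x) h).1 rfl
  exact ⟨{ toFun := g
           map_sup' := fun x y => hgr (BooleanSubalgebra.sup_mem (hg x) (hg y))
           map_inf' := fun x y => hgr (BooleanSubalgebra.inf_mem (hg x) (hg y))
           map_top' := hgr BooleanSubalgebra.top_mem
           map_bot' := hgr BooleanSubalgebra.bot_mem },
    fun x y h => (fst_eq_iff_of_mem_graphSubalgebra hi hf (hg x) (hg y)).2 h,
    fun a => hgr (mk_mem_graphSubalgebra a)⟩

end BooleanExtension

/-- This makes the open generators of `diamondAlgebra` redundant. -/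
theorem compl_closedReg {A : Type*} [Order.Frame A] (a : A) : (closedReg a)ᶜ = openReg a :=
  Heyting.Regular.coe_injective (isCompl_closedNucleus_openNucleus a).compl_eq

theorem closure_range_diamond (A : Type*) [Order.Frame A] :
    BooleanSubalgebra.closure (Set.range (diamond : BoundedLatticeHom A (diamondAlgebra A))) =
      ⊤ := by
  refine top_le_iff.1 ?_
  rintro ⟨x, hx⟩ -
  -- The induction runs in the ambient algebra of regular elements, while the conclusion concerns a
  -- closure inside the subtype; hence the predicate carries the membership proof.
  refine BooleanSubalgebra.closure_bot_sup_induction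
    (p := fun x hx => (⟨x, hx⟩ : diamondAlgebra A) ∈
      BooleanSubalgebra.closure (Set.range (diamond : BoundedLatticeHom A (diamondAlgebra A))))
    ?_ BooleanSubalgebra.bot_mem (fun x hx y hy => BooleanSubalgebra.sup_mem)
    (fun x hx => BooleanSubalgebra.compl_mem) hx
  rintro _ (⟨a, rfl⟩ | ⟨a, rfl⟩)
  · exact BooleanSubalgebra.subset_closure ⟨a, rfl⟩
  · have h := BooleanSubalgebra.compl_mem (BooleanSubalgebra.subset_closure
      (Set.mem_range_self (f := (diamond : BoundedLatticeHom A (diamondAlgebra A))) a))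
    convert h using 1
    exact Subtype.ext (compl_closedReg a).symm

theorem theorem4p7 {H : Type*} [NormedAddCommGroup H] [InnerProductSpace ℂ H] [CompleteSpace H]
    (N : VonNeumannAlgebra H) (V : Set (AbelianSubalgebra N))
    {B : Type*} [BooleanAlgebra B]
    (f : BoundedLatticeHom (ClopenSubobject V) B) (hf : Function.Injective f) :
    ∃ g : BoundedLatticeHom (diamondAlgebra (ClopenSubobject V)) B,
      Function.Injective g ∧ (∀ x, g xᶜ = (g x)ᶜ) ∧ (∀ a, g (diamond a) = f a) ∧
        ∀ g' : BoundedLatticeHom (diamondAlgebra (ClopenSubobject V)) B,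
          (∀ a, g' (diamond a) = f a) → g' = g := by
  obtain ⟨g, hg, hgf⟩ := exists_injective_extension diamond_injective hf
    (closure_range_diamond (ClopenSubobject V))
  -- Bounded lattice homomorphisms between Boolean algebras preserve complements automatically, so
  -- uniqueness among them is uniqueness among Boolean homomorphisms.
  refine ⟨g, hg, map_compl' g, hgf, fun g' hg' => ?_⟩
  refine BoundedLatticeHom.ext_of_closure_eq_top (closure_range_diamond (ClopenSubobject V)) ?_
  rintro _ ⟨a, rfl⟩
  rw [hg', hgf]
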